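/- Let $\mathcal A$ be a unital $C^*$-algebra and let $\{\pi_i:\mathcal A\to \mathbf L(\mathcal H_i)\}_i$ be a family of pairwise (unitarily) inequivalent irreducible representations such that $\pi=\bigoplus_i\pi_i$, acting on the Hilbert space $\mathcal H=\bigoplus_i\mathcal H_i$, is faithful. Regard $\mathcal A$ as a subalgebra of $\mathbf L(\mathcal H)$ via $\pi$, the spatial tensor products $\mathcal A\check\otimes\mathcal A$ and $\mathcal A\check\otimes\mathcal A\check\otimes\mathcal A$ as algebras of operators on the Hilbert space tensor products $\mathcal H\bar\otimes\mathcal H$ and $\mathcal H\bar\otimes\mathcal H\bar\otimes\mathcal H$, and write $\mathcal A''=\pi(\mathcal A)''$. Let $P_\delta$ be the supremum of all projections $p\otimes p$ with $p$ a minimal projection of $\mathcal A''$, and let $\mathcal H_\delta\subseteq\mathcal H\bar\otimes\mathcal H$ be its image. Let $\rho\in\mathcal A\check\otimes\mathcal A$ be a quantum metric with respect to $\pi$, that is: (i) $\rho\ge 0$; (ii) $\rho P_\delta=P_\delta\rho=0$; (iii) $0$ is not an eigenvalue of $\rho|_{\mathcal H_\delta^\perp}\in\mathbf L(\mathcal H_\delta^\perp)$;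 (iv) $\rho$ is invariant under the flip $a\otimes b\mapsto b\otimes a$; (v) $\mathfrak M(\rho)\le\rho\otimes 1+1\otimes\rho$, where $\mathfrak M:\mathcal A\check\otimes\mathcal A\to\mathcal A\check\otimes\mathcal A\check\otimes\mathcal A$ is the $*$-morphism with $\mathfrak M(a\otimes b)=a\otimes1\otimes b$. Let $\rho^{-1}$ be the inverse of the injective operator $\rho|_{\mathcal H_\delta^\perp}$, defined on the image of $\rho|_{\mathcal H_\delta^\perp}$. For $a\in\mathcal A$ let $\|a\|_{Lip}\in[0,\infty]$ be the operator norm of $(a\otimes1-1\otimes a)\rho^{-1}$ as an operator from the image of $\rho|_{\mathcal H_\delta^\perp}$ into $\mathcal H\bar\otimes\mathcal H$, and for states $\phi,\psi$ of $\mathcal A$ let $$d(\phi,\psi)=\sup\{|\phi(a)-\psi(a)| : a\in\mathcal A,\ a^*=a,\ \|a\|_{Lip}\le1\}\in[0,\infty].$$ Let $i\ne j$, let $v\in\mathcal H_i$ and $w\in\mathcal H_j$ be unit vectors, regarded also as vectors of $\mathcal H$, and let $\phi(a)=\langle\pi_i(a)v,v\rangle$ and $\psi(a)=\langle\pi_j(a)w,w\rangle$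 be the corresponding vector states (which are pure, because $\pi_i$ and $\pi_j$ are irreducible). Then $$d(\phi,\psi)\le\|\rho(v\otimes w)\|.$$ -/

import Mathlib

open scoped TensorProduct ENNReal InnerProductSpace ComplexOrder

noncomputable section

namespace QMetric

open UniformSpace

/-! ## Hilbert space tensor products -/

section HilbertTensor

variable {E F G E' F' : Type*}
  [NormedAddCommGroup E] [InnerProductSpace ℂ E]
  [NormedAddCommGroup F] [InnerProductSpace ℂ F]
  [NormedAddCommGroup G] [InnerProductSpace ℂ G]
  [NormedAddCommGroup E'] [InnerProductSpace ℂ E']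
  [NormedAddCommGroup F'] [InnerProductSpace ℂ F']

/-- The Hilbert space tensor product: the completion of the algebraic tensor product with respect
to the inner product `⟪x ⊗ y, x' ⊗ y'⟫ = ⟪x, x'⟫ ⟪y, y'⟫`. -/
abbrev HTensor (E F : Type*) [NormedAddCommGroup E] [InnerProductSpace ℂ E]
    [NormedAddCommGroup F] [InnerProductSpace ℂ F] : Type _ :=
  Completion (E ⊗[ℂ] F)

/-- The elementary tensor `x ⊗ y`. -/
def htmul (x : E) (y : F) : HTensor E F := ((x ⊗ₜ[ℂ] y : E ⊗[ℂ] F) : Completion (E ⊗[ℂ] F))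

/-- The tensor product `S ⊗ T` of two bounded operators, acting on the Hilbert tensor product. -/
def hmap (S : E →L[ℂ] E') (T : F →L[ℂ] F') : HTensor E F →L[ℂ] HTensor E' F' :=
  (TensorProduct.mapL S T).completion

theorem hmap_htmul (S : E →L[ℂ] E') (T : F →L[ℂ] F') (x : E) (y : F) :
    hmap S T (htmul x y) = htmul (S x) (T y) := by
  simp [hmap, htmul]

/-- The flip unitary `x ⊗ y ↦ y ⊗ x`. -/
def hflip (E F : Type*) [NormedAddCommGroup E] [InnerProductSpace ℂ E]
    [NormedAddCommGroup F] [InnerProductSpace ℂ F] : HTensor E F ≃ₗᵢ[ℂ] HTensor F E :=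
  (TensorProduct.commIsometry ℂ E F).toLinearEquiv.extendOfIsometry
    (Completion.toComplₗᵢ (𝕜 := ℂ) (E := E ⊗[ℂ] F)).toLinearMap
    (Completion.toComplₗᵢ (𝕜 := ℂ) (E := F ⊗[ℂ] E)).toLinearMap
    Completion.denseRange_coe Completion.denseRange_coe (by intro x; simp)

theorem hflip_htmul (x : E) (y : F) : hflip E F (htmul x y) = htmul y x := by
  have h := LinearEquiv.extendOfIsometry_eq (f := (TensorProduct.commIsometry ℂ E F).toLinearEquiv)
    (e₁ := (Completion.toComplₗᵢ (𝕜 := ℂ) (E := E ⊗[ℂ] F)).toLinearMap)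
    (e₂ := (Completion.toComplₗᵢ (𝕜 := ℂ) (E := F ⊗[ℂ] E)).toLinearMap)
    Completion.denseRange_coe Completion.denseRange_coe (by intro x; simp) (x ⊗ₜ[ℂ] y)
  simpa [hflip, htmul] using h

theorem htmul_dense {D : Set (HTensor E F)} (hD : IsClosed D)
    (h0 : 0 ∈ D) (hadd : ∀ a ∈ D, ∀ b ∈ D, a + b ∈ D) (ht : ∀ x y, htmul x y ∈ D)
    (z : HTensor E F) : z ∈ D := by
  induction z using Completion.induction_on with
  | hp => exact hD
  | ih a =>
    induction a using TensorProduct.induction_on with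
    | zero => exact Completion.coe_zero (α := E ⊗[ℂ] F) ▸ h0
    | tmul x y => exact ht x y
    | add a b ha hb => rw [Completion.coe_add]; exact hadd _ ha _ hb

theorem continuous_htmul_left (y : F) : Continuous fun x : E => htmul x y :=
  (Completion.continuous_coe _).comp
    (((TensorProduct.mkL (𝕜 := ℂ) (E := E) (F := F)).flip y).continuous)

theorem continuous_htmul_right (x : E) : Continuous fun y : F => htmul x y :=
  (Completion.continuous_coe _).comp
    (((TensorProduct.mkL (𝕜 := ℂ) (E := E) (F := F)) x).continuous)

/-- The inclusion of `(E ⊗ F) ⊗ G` in the left bracketed triple Hilbert tensor product. -/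
def tripleLeft (E F G : Type*) [NormedAddCommGroup E] [InnerProductSpace ℂ E]
    [NormedAddCommGroup F] [InnerProductSpace ℂ F] [NormedAddCommGroup G] [InnerProductSpace ℂ G] :
    ((E ⊗[ℂ] F) ⊗[ℂ] G) →ₗᵢ[ℂ] HTensor (HTensor E F) G :=
  Completion.toComplₗᵢ.comp
    (LinearIsometry.rTensor G (Completion.toComplₗᵢ (𝕜 := ℂ) (E := E ⊗[ℂ] F)))

/-- The inclusion of `E ⊗ (F ⊗ G)` in the right bracketed triple Hilbert tensor product. -/
def tripleRight (E F G : Type*) [NormedAddCommGroup E] [InnerProductSpace ℂ E]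
    [NormedAddCommGroup F] [InnerProductSpace ℂ F] [NormedAddCommGroup G] [InnerProductSpace ℂ G] :
    (E ⊗[ℂ] (F ⊗[ℂ] G)) →ₗᵢ[ℂ] HTensor E (HTensor F G) :=
  Completion.toComplₗᵢ.comp
    (LinearIsometry.lTensor E (Completion.toComplₗᵢ (𝕜 := ℂ) (E := F ⊗[ℂ] G)))

theorem tripleLeft_tmul (x : E) (y : F) (z : G) :
    tripleLeft E F G ((x ⊗ₜ y) ⊗ₜ z) = htmul (htmul x y) z := by
  simp [tripleLeft, htmul]

theorem tripleRight_tmul (x : E) (y : F) (z : G) :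
    tripleRight E F G (x ⊗ₜ (y ⊗ₜ z)) = htmul x (htmul y z) := by
  simp [tripleRight, htmul]

theorem denseRange_tripleLeft : DenseRange (tripleLeft E F G) := by
  have hmem : ∀ a ∈ closure (Set.range (tripleLeft E F G)),
      ∀ b ∈ closure (Set.range (tripleLeft E F G)),
      a + b ∈ closure (Set.range (tripleLeft E F G)) := fun a ha b hb =>
    (LinearMap.range (tripleLeft E F G).toLinearMap).topologicalClosure.add_mem ha hb
  have h0 : (0 : HTensor (HTensor E F) G) ∈ closure (Set.range (tripleLeft E F G)) :=
    subset_closure ⟨0, LinearIsometry.map_zero _⟩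
  intro t
  refine htmul_dense isClosed_closure h0 hmem (fun u z => ?_) t
  refine htmul_dense (D := {u | htmul u z ∈ closure (Set.range (tripleLeft E F G))})
    (isClosed_closure.preimage (continuous_htmul_left z)) ?_ ?_ (fun x y => ?_) u
  · have h1 : htmul (0 : HTensor E F) z = 0 := by
      rw [htmul, TensorProduct.zero_tmul]; exact Completion.coe_zero
    change htmul (0 : HTensor E F) z ∈ closure _
    rw [h1]; exact h0
  · intro a ha b hb
    have := hmem _ ha _ hb
    simpa [htmul, TensorProduct.add_tmul, Completion.coe_add] using this
  · exact subset_closure ⟨_, tripleLeft_tmul x y z⟩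

theorem denseRange_tripleRight : DenseRange (tripleRight E F G) := by
  have hmem : ∀ a ∈ closure (Set.range (tripleRight E F G)),
      ∀ b ∈ closure (Set.range (tripleRight E F G)),
      a + b ∈ closure (Set.range (tripleRight E F G)) := fun a ha b hb =>
    (LinearMap.range (tripleRight E F G).toLinearMap).topologicalClosure.add_mem ha hb
  have h0 : (0 : HTensor E (HTensor F G)) ∈ closure (Set.range (tripleRight E F G)) :=
    subset_closure ⟨0, LinearIsometry.map_zero _⟩
  intro t
  refine htmul_dense isClosed_closure h0 hmem (fun x u => ?_) t
  refine htmul_dense (D := {u | htmul x u ∈ closure (Set.range (tripleRight E F G))})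
    (isClosed_closure.preimage (continuous_htmul_right x)) ?_ ?_ (fun y z => ?_) u
  · have h1 : htmul x (0 : HTensor F G) = 0 := by
      rw [htmul, TensorProduct.tmul_zero]; exact Completion.coe_zero
    change htmul x (0 : HTensor F G) ∈ closure _
    rw [h1]; exact h0
  · intro a ha b hb
    have := hmem _ ha _ hb
    simpa [htmul, TensorProduct.tmul_add, Completion.coe_add] using this
  · exact subset_closure ⟨_, tripleRight_tmul x y z⟩

/-- The associativity unitary `(x ⊗ y) ⊗ z ↦ x ⊗ (y ⊗ z)`. -/
def hassoc (E F G : Type*) [NormedAddCommGroup E] [InnerProductSpace ℂ E]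
    [NormedAddCommGroup F] [InnerProductSpace ℂ F] [NormedAddCommGroup G] [InnerProductSpace ℂ G] :
    HTensor (HTensor E F) G ≃ₗᵢ[ℂ] HTensor E (HTensor F G) :=
  (TensorProduct.assocIsometry ℂ E F G).toLinearEquiv.extendOfIsometry
    (tripleLeft E F G).toLinearMap (tripleRight E F G).toLinearMap
    denseRange_tripleLeft denseRange_tripleRight (by intro x; simp)

theorem hassoc_htmul (x : E) (y : F) (z : G) :
    hassoc E F G (htmul (htmul x y) z) = htmul x (htmul y z) := by
  have h := LinearEquiv.extendOfIsometry_eq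
    (f := (TensorProduct.assocIsometry ℂ E F G).toLinearEquiv)
    (e₁ := (tripleLeft E F G).toLinearMap) (e₂ := (tripleRight E F G).toLinearMap)
    denseRange_tripleLeft denseRange_tripleRight (by intro x; simp) ((x ⊗ₜ y) ⊗ₜ z)
  simpa [hassoc, tripleLeft_tmul, tripleRight_tmul] using h

/-- The flip of operators `S ⊗ T ↦ T ⊗ S` on `L(E ⊗ E)`, implemented by the flip unitary. -/
def opFlip (X : HTensor E E →L[ℂ] HTensor E E) : HTensor E E →L[ℂ] HTensor E E :=
  (hflip E E : HTensor E E →L[ℂ] HTensor E E) ∘L X ∘L (hflip E E : HTensor E E →L[ℂ] HTensor E E)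

/-- `X ⊗ 1` on `E ⊗ E ⊗ E`. -/
def leg12 (X : HTensor E E →L[ℂ] HTensor E E) :
    HTensor (HTensor E E) E →L[ℂ] HTensor (HTensor E E) E :=
  hmap X (ContinuousLinearMap.id ℂ E)

/-- `1 ⊗ X` on `E ⊗ E ⊗ E`. -/
def leg23 (X : HTensor E E →L[ℂ] HTensor E E) :
    HTensor (HTensor E E) E →L[ℂ] HTensor (HTensor E E) E :=
  ((hassoc E E E).symm : HTensor E (HTensor E E) →L[ℂ] HTensor (HTensor E E) E) ∘L
    hmap (ContinuousLinearMap.id ℂ E) X ∘L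
    (hassoc E E E : HTensor (HTensor E E) E →L[ℂ] HTensor E (HTensor E E))

/-- The map `S ⊗ T ↦ S ⊗ 1 ⊗ T` putting `1` in the mid position: conjugation of `X ⊗ 1` by the
unitary that exchanges the last two tensor factors. -/
def leg13 (X : HTensor E E →L[ℂ] HTensor E E) :
    HTensor (HTensor E E) E →L[ℂ] HTensor (HTensor E E) E :=
  leg23 (hflip E E : HTensor E E →L[ℂ] HTensor E E) ∘L leg12 X ∘L
    leg23 (hflip E E : HTensor E E →L[ℂ] HTensor E E)

theorem ext_htmul {S T : HTensor E F →L[ℂ] G} (h : ∀ x y, S (htmul x y) = T (htmul x y)) :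
    S = T := by
  ext z
  refine htmul_dense (D := {z | S z = T z}) (isClosed_eq S.continuous T.continuous) (by simp)
    ?_ h z
  intro a ha b hb
  simp only [Set.mem_ofPred_eq] at ha hb ⊢
  rw [map_add, map_add, ha, hb]

theorem opFlip_hmap (S T : E →L[ℂ] E) : opFlip (hmap S T) = hmap T S :=
  ext_htmul fun x y => by simp [opFlip, hflip_htmul, hmap_htmul]

theorem leg12_apply (S T : E →L[ℂ] E) (x y z : E) :
    leg12 (hmap S T) (htmul (htmul x y) z) = htmul (htmul (S x) (T y)) z := by
  simp [leg12, hmap_htmul]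

theorem hassoc_symm_htmul (x : E) (y : F) (z : G) :
    (hassoc E F G).symm (htmul x (htmul y z)) = htmul (htmul x y) z := by
  rw [← hassoc_htmul, LinearIsometryEquiv.symm_apply_apply]

theorem leg23_apply (S T : E →L[ℂ] E) (x y z : E) :
    leg23 (hmap S T) (htmul (htmul x y) z) = htmul (htmul x (S y)) (T z) := by
  simp [leg23, hmap_htmul, hassoc_htmul, hassoc_symm_htmul]

theorem leg13_apply (S T : E →L[ℂ] E) (x y z : E) :
    leg13 (hmap S T) (htmul (htmul x y) z) = htmul (htmul (S x) y) (T z) := by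
  simp [leg13, leg12, leg23, hmap_htmul, hassoc_htmul, hassoc_symm_htmul, hflip_htmul]

end HilbertTensor

/-! ## Atomic representations -/

section Representations

variable {A : Type*} [CStarAlgebra A]

/-- A (topologically) irreducible representation: the space is nonzero and the only closed
invariant subspaces are the trivial ones. -/
def IsIrreducibleRep {K : Type*} [NormedAddCommGroup K] [InnerProductSpace ℂ K] [CompleteSpace K]
    (σ : A →⋆ₐ[ℂ] (K →L[ℂ] K)) : Prop :=
  Nontrivial K ∧ ∀ M : Submodule ℂ K, IsClosed (M : Set K) →
    (∀ a, ∀ x ∈ M, σ a x ∈ M) → M = ⊥ ∨ M = ⊤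

/-- Unitary equivalence of representations. -/
def EquivReps {K L : Type*} [NormedAddCommGroup K] [InnerProductSpace ℂ K] [CompleteSpace K]
    [NormedAddCommGroup L] [InnerProductSpace ℂ L] [CompleteSpace L]
    (σ : A →⋆ₐ[ℂ] (K →L[ℂ] K)) (τ : A →⋆ₐ[ℂ] (L →L[ℂ] L)) : Prop :=
  ∃ U : K ≃ₗᵢ[ℂ] L, ∀ a x, U (σ a x) = τ a (U x)

variable {ι : Type*} {H : ι → Type*} [∀ i, NormedAddCommGroup (H i)]
  [∀ i, InnerProductSpace ℂ (H i)] [∀ i, CompleteSpace (H i)]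

/-- The Hilbert space direct sum `⊕ Hᵢ`. -/
abbrev HSum (H : ι → Type*) [∀ i, NormedAddCommGroup (H i)] : Type _ := lp H 2

theorem norm_rep_le (π : ∀ i, A →⋆ₐ[ℂ] (H i →L[ℂ] H i)) (a : A) (x : HSum H) (i : ι) :
    ‖π i a (x i)‖ ≤ ‖(((‖a‖ : ℂ) • x : HSum H) : ∀ i, H i) i‖ := by
  have h : ‖π i a‖ ≤ ‖a‖ := NonUnitalStarAlgHom.norm_apply_le (π i) a
  refine ((π i a).le_opNorm (x i)).trans ?_
  simp only [lp.coeFn_smul, Pi.smul_apply, norm_smul, Complex.norm_real, norm_norm]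
  gcongr

theorem memℓp_rep (π : ∀ i, A →⋆ₐ[ℂ] (H i →L[ℂ] H i)) (a : A) (x : HSum H) :
    Memℓp (fun i => π i a (x i)) 2 :=
  (lp.memℓp ((‖a‖ : ℂ) • x)).mono' (norm_rep_le π a x)

/-- The operator `⊕ πᵢ(a)` on `⊕ Hᵢ`. -/
def sumOp (π : ∀ i, A →⋆ₐ[ℂ] (H i →L[ℂ] H i)) (a : A) : HSum H →L[ℂ] HSum H :=
  LinearMap.mkContinuous
    { toFun := fun x => ⟨fun i => π i a (x i), memℓp_rep π a x⟩
      map_add' := fun x y => by ext i; exact (π i a).map_add (x i) (y i)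
      map_smul' := fun c x => by ext i; simp } ‖a‖ (fun x => by
        have h := lp.norm_mono (p := 2) two_ne_zero
          (x := (⟨fun i => π i a (x i), memℓp_rep π a x⟩ : HSum H))
          (y := ((‖a‖ : ℂ) • x : HSum H)) (norm_rep_le π a x)
        rwa [norm_smul, Complex.norm_real, norm_norm] at h)

@[simp]
theorem sumOp_apply (π : ∀ i, A →⋆ₐ[ℂ] (H i →L[ℂ] H i)) (a : A) (x : HSum H) (i : ι) :
    sumOp π a x i = π i a (x i) := rfl

/-- The direct sum representation `π = ⊕ πᵢ` on `⊕ Hᵢ`. -/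
def sumRep (π : ∀ i, A →⋆ₐ[ℂ] (H i →L[ℂ] H i)) : A →⋆ₐ[ℂ] (HSum H →L[ℂ] HSum H) where
  toFun := sumOp π
  map_one' := by ext x i; simp
  map_mul' a b := by ext x i; simp
  map_zero' := by ext x i; simp
  map_add' a b := by ext x i; simp
  commutes' c := by ext x i; simp [Algebra.algebraMap_eq_smul_one]
  map_star' a := by
    rw [ContinuousLinearMap.star_eq_adjoint, ContinuousLinearMap.eq_adjoint_iff]
    intro x y
    rw [lp.inner_eq_tsum, lp.inner_eq_tsum]
    refine tsum_congr fun i => ?_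
    simp [map_star, ContinuousLinearMap.star_eq_adjoint, ContinuousLinearMap.adjoint_inner_left]

@[simp]
theorem sumRep_apply (π : ∀ i, A →⋆ₐ[ℂ] (H i →L[ℂ] H i)) (a : A) (x : HSum H) (i : ι) :
    sumRep π a x i = π i a (x i) := rfl

/-- `⊕ πᵢ` is a faithful atomic representation: the `πᵢ` are irreducible and pairwise
inequivalent, and their direct sum is injective. -/
structure IsFaithfulAtomic (π : ∀ i, A →⋆ₐ[ℂ] (H i →L[ℂ] H i)) : Prop where
  irreducible : ∀ i, IsIrreducibleRep (π i)
  inequivalent : ∀ i j, i ≠ j → ¬ EquivReps (π i) (π j)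
  faithful : Function.Injective (sumRep π)

/-! ## Quantum metrics -/

/-- The bounded operators on `H ⊗ H` where `H = ⊕ Hᵢ`. -/
abbrev PairOp (H : ι → Type*) [∀ i, NormedAddCommGroup (H i)] [∀ i, InnerProductSpace ℂ (H i)] :
    Type _ :=
  HTensor (HSum H) (HSum H) →L[ℂ] HTensor (HSum H) (HSum H)

/-- The spatial tensor product of `A` with itself, realised on `H ⊗ H` by means of `π = ⊕ πᵢ`: the
norm closure of the linear span of the operators `π(a) ⊗ π(b)`. -/
def spatialTensor (π : ∀ i, A →⋆ₐ[ℂ] (H i →L[ℂ] H i)) : Submodule ℂ (PairOp H) :=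
  (Submodule.span ℂ
    (Set.range fun p : A × A => (hmap (sumRep π p.1) (sumRep π p.2) : PairOp H))).topologicalClosure

/-- The enveloping von Neumann algebra `A'' = π(A)''`, as a set of operators on `H`. -/
def doubleCommutant (π : ∀ i, A →⋆ₐ[ℂ] (H i →L[ℂ] H i)) : Set (HSum H →L[ℂ] HSum H) :=
  Set.centralizer (Set.centralizer (Set.range (sumRep π)))

/-- Minimal projections of `A''`. -/
def IsMinimalProj (π : ∀ i, A →⋆ₐ[ℂ] (H i →L[ℂ] H i)) (p : HSum H →L[ℂ] HSum H) : Prop :=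
  p ∈ doubleCommutant π ∧ IsStarProjection p ∧ p ≠ 0 ∧
    ∀ q ∈ doubleCommutant π, IsStarProjection q → q ≤ p → q = 0 ∨ q = p

/-- `H_δ`: the closed linear span of the ranges of the projections `p ⊗ p` with `p` a minimal
projection of `A''`. -/
def diagSpace (π : ∀ i, A →⋆ₐ[ℂ] (H i →L[ℂ] H i)) :
    Submodule ℂ (HTensor (HSum H) (HSum H)) :=
  (⨆ (p : HSum H →L[ℂ] HSum H) (_ : IsMinimalProj π p),
    LinearMap.range (hmap p p : PairOp H).toLinearMap).topologicalClosure

instance (π : ∀ i, A →⋆ₐ[ℂ] (H i →L[ℂ] H i)) : (diagSpace π).HasOrthogonalProjection := by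
  unfold diagSpace
  infer_instance

/-- `P_δ`, the characteristic function of the diagonal: the supremum of the projections `p ⊗ p`
with `p` a minimal projection of `A''`, that is, the orthogonal projection onto `H_δ`. -/
def diagProj (π : ∀ i, A →⋆ₐ[ℂ] (H i →L[ℂ] H i)) : PairOp H :=
  (diagSpace π).starProjection

theorem isStarProjection_hmap {E : Type*} [NormedAddCommGroup E] [InnerProductSpace ℂ E]
    [CompleteSpace E] {p : E →L[ℂ] E} (hp : IsStarProjection p) :
    IsStarProjection (hmap p p) := by
  refine ⟨?_, ?_⟩
  · refine ext_htmul fun x y => ?_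
    have h : ∀ x, p (p x) = p x := fun x => congrArg (fun T => T x) hp.isIdempotentElem
    simp [hmap_htmul, h]
  · rw [ContinuousLinearMap.isSelfAdjoint_iff', eq_comm, ContinuousLinearMap.eq_adjoint_iff]
    intro z w
    have hs : ∀ x y, ⟪p x, y⟫_ℂ = ⟪x, p y⟫_ℂ := by
      intro x y
      conv_lhs => rw [← hp.isSelfAdjoint.star_eq]
      rw [ContinuousLinearMap.star_eq_adjoint, ContinuousLinearMap.adjoint_inner_left]
    refine htmul_dense (D := {z | ⟪hmap p p z, w⟫_ℂ = ⟪z, hmap p p w⟫_ℂ})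
      (isClosed_eq (by fun_prop) (by fun_prop)) (by simp) ?_ (fun x y => ?_) z
    · intro a ha b hb
      simp only [Set.mem_ofPred_eq, map_add, inner_add_left] at ha hb ⊢
      rw [ha, hb]
    refine htmul_dense (D := {w | ⟪hmap p p (htmul x y), w⟫_ℂ = ⟪htmul x y, hmap p p w⟫_ℂ})
      (isClosed_eq (by fun_prop) (by fun_prop)) (by simp) ?_ (fun x' y' => ?_) w
    · intro a ha b hb
      simp only [Set.mem_ofPred_eq, map_add, inner_add_right] at ha hb ⊢
      rw [ha, hb]
    rw [Set.mem_ofPred_eq, hmap_htmul, hmap_htmul]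
    simp [htmul, hs]

/-- `P_δ` is the least upper bound, among all projections, of the projections `p ⊗ p` with `p` a
minimal projection of `A''`. -/
theorem diagProj_le_iff (π : ∀ i, A →⋆ₐ[ℂ] (H i →L[ℂ] H i)) (Q : PairOp H)
    (hQ : IsStarProjection Q) :
    diagProj π ≤ Q ↔ ∀ p, IsMinimalProj π p → (hmap p p : PairOp H) ≤ Q := by
  obtain ⟨K, hK, rfl⟩ := isStarProjection_iff_eq_starProjection.mp hQ
  have key : ∀ p, IsMinimalProj π p → ((hmap p p : PairOp H) ≤ K.starProjection ↔
      LinearMap.range (hmap p p : PairOp H).toLinearMap ≤ K) := by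
    intro p hp
    obtain ⟨h1, h2⟩ := isStarProjection_iff_eq_starProjection_range.mp
      (isStarProjection_hmap hp.2.1)
    conv_lhs => rw [h2]
    exact Submodule.starProjection_le_starProjection_iff
  have hKc : IsClosed (K : Set (HTensor (HSum H) (HSum H))) := by
    rw [← Submodule.orthogonal_orthogonal K]
    exact Submodule.isClosed_orthogonal _
  unfold diagProj
  rw [Submodule.starProjection_le_starProjection_iff, diagSpace]
  constructor
  · intro h p hp
    rw [key p hp]
    exact (le_iSup₂_of_le p hp le_rfl).trans ((Submodule.le_topologicalClosure _).trans h)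
  · intro h
    exact Submodule.topologicalClosure_minimal _ (iSup₂_le fun p hp => (key p hp).1 (h p hp)) hKc

/-- Quantum metrics with respect to `π = ⊕ πᵢ`. -/
structure IsQuantumMetric (π : ∀ i, A →⋆ₐ[ℂ] (H i →L[ℂ] H i)) (ρ : PairOp H) : Prop where
  mem_tensor : ρ ∈ spatialTensor π
  nonneg : 0 ≤ ρ
  flip_eq : opFlip ρ = ρ
  triangle : leg13 ρ ≤ leg12 ρ + leg23 ρ
  mul_diagProj : ρ * diagProj π = 0
  diagProj_mul : diagProj π * ρ = 0
  /-- `0` is not an eigenvalue of the restriction of `ρ` to the orthogonal complement of `H_δ`. -/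
  not_eigenvalue : ∀ ξ ∈ (diagSpace π)ᗮ, ρ ξ = 0 → ξ = 0

/-! ## The Lipschitz seminorm and the Monge-Kantorovich semimetric -/

/-- The restriction of `ρ` to the orthogonal complement of `H_δ`. -/
def offDiag (π : ∀ i, A →⋆ₐ[ℂ] (H i →L[ℂ] H i)) (ρ : PairOp H) :
    (diagSpace π)ᗮ →ₗ[ℂ] HTensor (HSum H) (HSum H) :=
  ρ.toLinearMap.domRestrict (diagSpace π)ᗮ

theorem IsQuantumMetric.offDiag_injective {π : ∀ i, A →⋆ₐ[ℂ] (H i →L[ℂ] H i)} {ρ : PairOp H}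
    (hρ : IsQuantumMetric π ρ) : Function.Injective (offDiag π ρ) := by
  rw [injective_iff_map_eq_zero]
  intro ξ hξ
  exact Subtype.ext (hρ.not_eigenvalue ξ ξ.2 hξ)

/-- `ρ⁻¹`, the inverse of the restriction of `ρ` to the orthogonal complement of `H_δ`, defined on
the image of that restriction. -/
def rhoInv {π : ∀ i, A →⋆ₐ[ℂ] (H i →L[ℂ] H i)} {ρ : PairOp H} (hρ : IsQuantumMetric π ρ) :
    LinearMap.range (offDiag π ρ) →ₗ[ℂ] HTensor (HSum H) (HSum H) :=
  (diagSpace π)ᗮ.subtype ∘ₗ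
    (LinearEquiv.ofInjective (offDiag π ρ) hρ.offDiag_injective).symm.toLinearMap

/-- The operator norm, possibly infinite, of a linear map that need not be bounded. -/
def extOpNorm {E F : Type*} [SeminormedAddCommGroup E] [Module ℂ E]
    [SeminormedAddCommGroup F] [Module ℂ F] (T : E →ₗ[ℂ] F) : ℝ≥0∞ :=
  ⨆ (x : E) (_ : ‖x‖ ≤ 1), ‖T x‖ₑ

/-- The operator `a ⊗ 1 - 1 ⊗ a` on `H ⊗ H`. -/
def commOp (π : ∀ i, A →⋆ₐ[ℂ] (H i →L[ℂ] H i)) (a : A) : PairOp H :=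
  hmap (sumRep π a) (ContinuousLinearMap.id ℂ (HSum H)) -
    hmap (ContinuousLinearMap.id ℂ (HSum H)) (sumRep π a)

/-- The Lipschitz seminorm `‖a‖_Lip = ‖(a ⊗ 1 - 1 ⊗ a) ρ⁻¹‖ ∈ [0, ∞]`. -/
def lipNorm {π : ∀ i, A →⋆ₐ[ℂ] (H i →L[ℂ] H i)} {ρ : PairOp H} (hρ : IsQuantumMetric π ρ)
    (a : A) : ℝ≥0∞ :=
  extOpNorm ((commOp π a).toLinearMap ∘ₗ rhoInv hρ)

variable (A) in
/-- States of a unital C⋆-algebra: positive linear functionals taking the value `1` at `1`. -/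
structure CState where
  toLin : A →ₗ[ℂ] ℂ
  nonneg : ∀ a, 0 ≤ toLin (star a * a)
  map_one : toLin 1 = 1

/-- The Monge-Kantorovich semimetric on the state space, with values in `[0, ∞]`. -/
def mkDist {π : ∀ i, A →⋆ₐ[ℂ] (H i →L[ℂ] H i)} {ρ : PairOp H} (hρ : IsQuantumMetric π ρ)
    (φ ψ : CState A) : ℝ≥0∞ :=
  ⨆ (a : A) (_ : star a = a) (_ : lipNorm hρ a ≤ 1), ‖φ.toLin a - ψ.toLin a‖ₑ

/-- The vector state `a ↦ ⟨σ(a) v, v⟩` of a unit vector `v`. (Mathlib's inner product is conjugate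
linear in its first argument.) -/
def vectorState {K : Type*} [NormedAddCommGroup K] [InnerProductSpace ℂ K] [CompleteSpace K]
    (σ : A →⋆ₐ[ℂ] (K →L[ℂ] K)) (v : K) (hv : ‖v‖ = 1) : CState A where
  toLin :=
    { toFun := fun a => ⟪v, σ a v⟫_ℂ
      map_add' := fun a b => by simp
      map_smul' := fun c a => by simp }
  nonneg a := by
    have h : ⟪v, σ (star a * a) v⟫_ℂ = ⟪σ a v, σ a v⟫_ℂ := by
      rw [map_mul, map_star, ContinuousLinearMap.star_eq_adjoint, mul_apply_eq_comp,
        ContinuousLinearMap.adjoint_inner_right]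
    change (0 : ℂ) ≤ ⟪v, σ (star a * a) v⟫_ℂ
    rw [h, inner_self_eq_norm_sq_to_K, ← RCLike.ofReal_pow]
    exact Complex.zero_le_real.2 (sq_nonneg _)
  map_one := by
    change ⟪v, σ 1 v⟫_ℂ = 1
    simp [inner_self_eq_norm_sq_to_K, hv]

open Classical in
/-- The vector `v ∈ Hᵢ` regarded as an element of `⊕ Hᵢ`. -/
def incl (i : ι) (v : H i) : HSum H := lp.single 2 i v

end Representations

end QMetric

end

/-!
If the representation on the block `Hᵢ` is disjoint from those on the other blocks, then the
projection onto `Hᵢ` lies in the commutant of `A` as well as in `A''`, so a minimal projection `p`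
of `A''` is either below it or orthogonal to it. In both cases `p ⊗ p` kills `ξ = v ⊗ w` when
`v ∈ Hᵢ`, `w ∈ Hⱼ` and `i ≠ j`; hence `ξ ⊥ H_δ`, and there
`‖(a ⊗ 1 - 1 ⊗ a) ξ‖ ≤ ‖a‖_Lip ‖ρ ξ‖`. It remains to observe that
`φ(a) - ψ(a) = ⟨(a ⊗ 1 - 1 ⊗ a) ξ, ξ⟩`. Disjointness of inequivalent irreducible representations is
Schur's lemma.
-/

noncomputable section

namespace QMetric

section HilbertTensor

variable {E F : Type*} [NormedAddCommGroup E] [InnerProductSpace ℂ E]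
  [NormedAddCommGroup F] [InnerProductSpace ℂ F]

theorem inner_htmul (x x' : E) (y y' : F) :
    ⟪htmul x y, htmul x' y'⟫_ℂ = ⟪x, x'⟫_ℂ * ⟪y, y'⟫_ℂ := by
  simp [htmul]

theorem norm_htmul (x : E) (y : F) : ‖htmul x y‖ = ‖x‖ * ‖y‖ := by
  simp [htmul]

theorem htmul_zero_left (y : F) : htmul (0 : E) y = 0 := by
  simp [htmul]

theorem htmul_zero_right (x : E) : htmul x (0 : F) = 0 := by
  simp [htmul]

end HilbertTensor

section SchurLemma

theorem exists_cfc_mul_cfc_eq_zero {B : Type*} {p : B → Prop} [Ring B] [StarRing B]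
    [TopologicalSpace B] [Algebra ℝ B] [ContinuousFunctionalCalculus ℝ B p] {b : B} (hb : p b)
    {s t : ℝ} (hs : s ∈ spectrum ℝ b) (ht : t ∈ spectrum ℝ b) (hst : s < t) :
    ∃ f g : ℝ → ℝ, cfc f b ≠ 0 ∧ cfc g b ≠ 0 ∧ cfc f b * cfc g b = 0 := by
  obtain ⟨m, hsm, hmt⟩ := exists_between hst
  have cfc_ne_zero {f : ℝ → ℝ} (hf : Continuous f) {r : ℝ} (hr : r ∈ spectrum ℝ b)
      (hfr : f r ≠ 0) : cfc f b ≠ 0 := by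
    rw [← cfc_const_zero ℝ b]
    exact fun h => hfr (eqOn_of_cfc_eq_cfc h (by fun_prop) (by fun_prop) hb hr)
  refine ⟨fun x => max (x - m) 0, fun x => max (m - x) 0,
    cfc_ne_zero (by fun_prop) ht (lt_max_of_lt_left (sub_pos.2 hmt)).ne',
    cfc_ne_zero (by fun_prop) hs (lt_max_of_lt_left (sub_pos.2 hsm)).ne', ?_⟩
  rw [← cfc_mul _ _ b (by fun_prop) (by fun_prop), ← cfc_const_zero ℝ b]
  refine cfc_congr fun x _ => ?_
  rcases le_total x m with h | h <;> simp [max_eq_right (sub_nonpos.2 h)]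

variable {A : Type*} [CStarAlgebra A]
  {K : Type*} [NormedAddCommGroup K] [InnerProductSpace ℂ K] [CompleteSpace K]
  {L : Type*} [NormedAddCommGroup L] [InnerProductSpace ℂ L] [CompleteSpace L]
  {M : Type*} [NormedAddCommGroup M] [InnerProductSpace ℂ M] [CompleteSpace M]
  {σ : A →⋆ₐ[ℂ] (K →L[ℂ] K)} {τ : A →⋆ₐ[ℂ] (L →L[ℂ] L)} {υ : A →⋆ₐ[ℂ] (M →L[ℂ] M)}

/-- `T` is a bounded intertwiner from the representation `σ` to the representation `τ`. -/
def Intertwines (σ : A →⋆ₐ[ℂ] (K →L[ℂ] K)) (τ : A →⋆ₐ[ℂ] (L →L[ℂ] L)) (T : K →L[ℂ] L) : Prop :=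
  ∀ a x, T (σ a x) = τ a (T x)

/-- The representations `σ` and `τ` are disjoint, in the form: there is no nonzero bounded
intertwiner from `σ` to `τ`. -/
def DisjointReps (σ : A →⋆ₐ[ℂ] (K →L[ℂ] K)) (τ : A →⋆ₐ[ℂ] (L →L[ℂ] L)) : Prop :=
  ∀ T : K →L[ℂ] L, Intertwines σ τ T → T = 0

theorem intertwines_self_iff_commute {T : K →L[ℂ] K} :
    Intertwines σ σ T ↔ ∀ a, Commute T (σ a) :=
  forall_congr' fun a => (ContinuousLinearMap.ext_iff (f := T * σ a) (g := σ a * T)).symm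

theorem Intertwines.comp {S : L →L[ℂ] M} {T : K →L[ℂ] L} (hS : Intertwines τ υ S)
    (hT : Intertwines σ τ T) : Intertwines σ υ (S ∘L T) := fun a x =>
  (congrArg S (hT a x)).trans (hS a (T x))

theorem Intertwines.adjoint {T : K →L[ℂ] L} (hT : Intertwines σ τ T) :
    Intertwines τ σ T.adjoint := by
  intro a y
  refine ext_inner_right ℂ fun x => ?_
  calc ⟪T.adjoint (τ a y), x⟫_ℂ = ⟪y, (τ a).adjoint (T x)⟫_ℂ := by
        simp only [ContinuousLinearMap.adjoint_inner_left, ContinuousLinearMap.adjoint_inner_right]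
    _ = ⟪y, T ((σ a).adjoint x)⟫_ℂ := by
        simp only [← ContinuousLinearMap.star_eq_adjoint, ← map_star, hT (star a) x]
    _ = ⟪σ a (T.adjoint y), x⟫_ℂ := by
        simp only [← ContinuousLinearMap.adjoint_inner_left, ContinuousLinearMap.adjoint_adjoint]

theorem IsIrreducibleRep.injective_of_intertwines (hσ : IsIrreducibleRep σ) {T : K →L[ℂ] L}
    (hT : Intertwines σ τ T) (hT₀ : T ≠ 0) : Function.Injective T := by
  have ker_invariant : ∀ a, ∀ x ∈ T.ker, σ a x ∈ T.ker := by
    intro a x hx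
    rw [LinearMap.mem_ker] at hx ⊢
    exact (hT a x).trans ((congrArg (τ a) hx).trans (map_zero _))
  rcases hσ.2 T.ker T.isClosed_ker ker_invariant with h | h
  · exact LinearMap.ker_eq_bot.1 h
  · exact absurd (ContinuousLinearMap.ext fun x => LinearMap.congr_fun (LinearMap.ker_eq_top.1 h) x)
      hT₀

theorem IsIrreducibleRep.equivReps_of_linearIsometry (hτ : IsIrreducibleRep τ) [Nontrivial K]
    (V : K →ₗᵢ[ℂ] L) (hV : Intertwines σ τ V.toContinuousLinearMap) : EquivReps σ τ := by
  have range_invariant : ∀ a, ∀ y ∈ V.range, τ a y ∈ V.range := by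
    rintro a _ ⟨x, rfl⟩
    exact ⟨σ a x, hV a x⟩
  rcases hτ.2 V.range V.isometry.isClosedEmbedding.isClosed_range range_invariant with h | h
  · obtain ⟨x, hx⟩ := exists_ne (0 : K)
    have hVx : V x = 0 := by simpa [h] using LinearMap.mem_range_self V.toLinearMap x
    exact absurd ((map_eq_zero_iff V V.injective).1 hVx) hx
  · exact ⟨LinearIsometryEquiv.ofSurjective V (LinearMap.range_eq_top.1 h), hV⟩

theorem IsIrreducibleRep.eq_algebraMap_of_isSelfAdjoint (hσ : IsIrreducibleRep σ)
    {T : K →L[ℂ] K} (hT : IsSelfAdjoint T) (hc : ∀ a, Commute T (σ a)) :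
    ∃ c : ℝ, T = algebraMap ℝ (K →L[ℂ] K) c := by
  have not_lt : ∀ s ∈ spectrum ℝ T, ∀ t ∈ spectrum ℝ T, ¬ s < t := by
    intro s hs t ht hst
    obtain ⟨f, g, hf, hg, hfg⟩ := exists_cfc_mul_cfc_eq_zero hT hs ht hst
    have f_injective := hσ.injective_of_intertwines
      (intertwines_self_iff_commute.2 fun a => (hc a).cfc_real f) hf
    exact hg (ContinuousLinearMap.ext fun x =>
      (map_eq_zero_iff _ f_injective).1 (DFunLike.congr_fun hfg x))
  have := hσ.1
  obtain ⟨c, hc⟩ := ContinuousFunctionalCalculus.spectrum_nonempty (R := ℝ) T hT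
  exact ⟨c, CFC.eq_algebraMap_of_spectrum_subset_singleton T c fun s hs =>
    le_antisymm (le_of_not_gt (not_lt c hc s hs)) (le_of_not_gt (not_lt s hs c hc))⟩

theorem norm_apply_eq_of_adjoint_comp_self_eq_algebraMap {T : K →L[ℂ] L} {c : ℝ}
    (hT : T.adjoint ∘L T = algebraMap ℝ (K →L[ℂ] K) c) (x : K) : ‖T x‖ = √c * ‖x‖ := by
  have hTx : T.adjoint (T x) = (c : ℂ) • x := by
    simpa [Algebra.algebraMap_eq_smul_one] using DFunLike.congr_fun hT x
  have re_inner : RCLike.re ⟪T.adjoint (T x), x⟫_ℂ = c * ‖x‖ ^ 2 := by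
    rw [hTx]
    simp [← Complex.ofReal_pow]
  calc ‖T x‖ = √(c * ‖x‖ ^ 2) := by rw [← re_inner]; exact T.apply_norm_eq_sqrt_inner_adjoint_left x
    _ = √c * ‖x‖ := by rw [Real.sqrt_mul' c (sq_nonneg _), Real.sqrt_sq (norm_nonneg x)]

theorem IsIrreducibleRep.disjointReps (hσ : IsIrreducibleRep σ) (hτ : IsIrreducibleRep τ)
    (hστ : ¬ EquivReps σ τ) : DisjointReps σ τ := by
  intro T hT
  by_contra hT₀
  obtain ⟨c, hc⟩ := hσ.eq_algebraMap_of_isSelfAdjoint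
    (ContinuousLinearMap.isPositive_adjoint_comp_self T).isSelfAdjoint
    (intertwines_self_iff_commute.1 (hT.adjoint.comp hT))
  have norm_T := norm_apply_eq_of_adjoint_comp_self_eq_algebraMap hc
  have sqrt_ne_zero : √c ≠ 0 := fun h =>
    hT₀ (ContinuousLinearMap.ext fun x => by simpa [h] using norm_T x)
  let V : K →ₗᵢ[ℂ] L :=
    { toLinearMap := (√c)⁻¹ • T.toLinearMap
      norm_map' := fun x => by
        simp [norm_smul, norm_T, abs_of_nonneg (Real.sqrt_nonneg c), sqrt_ne_zero] }
  have hV : Intertwines σ τ V.toContinuousLinearMap := fun a x => by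
    simp [V, hT a x]
  have := hσ.1
  exact hστ (hτ.equivReps_of_linearIsometry V hV)

theorem IsFaithfulAtomic.disjointReps {ι : Type*} {H : ι → Type*}
    [∀ i, NormedAddCommGroup (H i)] [∀ i, InnerProductSpace ℂ (H i)] [∀ i, CompleteSpace (H i)]
    {π : ∀ i, A →⋆ₐ[ℂ] (H i →L[ℂ] H i)} (hπ : IsFaithfulAtomic π) {i j : ι} (hij : i ≠ j) :
    DisjointReps (π i) (π j) :=
  (hπ.irreducible i).disjointReps (hπ.irreducible j) (hπ.inequivalent i j hij)

end SchurLemma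

section Blocks

variable {ι : Type*} {H : ι → Type*} [∀ i, NormedAddCommGroup (H i)]

theorem incl_apply_self (i : ι) (v : H i) : incl i v i = v := by
  classical
  exact lp.single_apply_self 2 i v

theorem incl_apply_of_ne {i k : ι} (h : k ≠ i) (v : H i) : incl i v k = 0 := by
  classical
  exact lp.single_apply_ne 2 i v h

theorem norm_incl (i : ι) (v : H i) : ‖incl i v‖ = ‖v‖ := by
  classical
  exact lp.norm_single two_pos i v

variable [∀ i, InnerProductSpace ℂ (H i)]

theorem inner_incl_left (i : ι) (v : H i) (x : HSum H) : ⟪incl i v, x⟫_ℂ = ⟪v, x i⟫_ℂ := by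
  classical
  exact lp.inner_single_left i v x

theorem inner_incl_right (i : ι) (v : H i) (x : HSum H) : ⟪x, incl i v⟫_ℂ = ⟪x i, v⟫_ℂ := by
  classical
  exact lp.inner_single_right i v x

open Classical in
/-- The inclusion `incl i` of `Hᵢ` in `⊕ Hᵢ` as a bounded operator. -/
def inclL (H : ι → Type*) [∀ i, NormedAddCommGroup (H i)] [∀ i, InnerProductSpace ℂ (H i)]
    (i : ι) : H i →L[ℂ] HSum H :=
  lp.singleContinuousLinearMap ℂ H 2 i

theorem incl_zero (i : ι) : incl i (0 : H i) = 0 := (inclL H i).map_zero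

/-- The orthogonal projection of `⊕ Hᵢ` onto the block `Hᵢ`, as an operator on `⊕ Hᵢ`. -/
def blockProj (H : ι → Type*) [∀ i, NormedAddCommGroup (H i)] [∀ i, InnerProductSpace ℂ (H i)]
    (i : ι) : HSum H →L[ℂ] HSum H :=
  inclL H i ∘L lp.evalCLM ℂ H 2 i

theorem blockProj_apply (i : ι) (x : HSum H) : blockProj H i x = incl i (x i) := rfl

theorem blockProj_incl_self (i : ι) (v : H i) : blockProj H i (incl i v) = incl i v := by
  rw [blockProj_apply, incl_apply_self]

theorem blockProj_incl_of_ne {i j : ι} (hij : i ≠ j) (w : H j) :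
    blockProj H i (incl j w) = 0 := by
  rw [blockProj_apply, incl_apply_of_ne hij, incl_zero]

variable [∀ i, CompleteSpace (H i)]

theorem isStarProjection_blockProj (i : ι) : IsStarProjection (blockProj H i) where
  isIdempotentElem := ContinuousLinearMap.ext fun x => blockProj_incl_self i (x i)
  isSelfAdjoint := by
    rw [ContinuousLinearMap.isSelfAdjoint_iff', eq_comm, ContinuousLinearMap.eq_adjoint_iff]
    intro x y
    rw [blockProj_apply, blockProj_apply, inner_incl_left, inner_incl_right]

variable {A : Type*} [CStarAlgebra A] {π : ∀ i, A →⋆ₐ[ℂ] (H i →L[ℂ] H i)}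

theorem sumRep_incl (π : ∀ i, A →⋆ₐ[ℂ] (H i →L[ℂ] H i)) (a : A) (i : ι) (v : H i) :
    sumRep π a (incl i v) = incl i (π i a v) := by
  ext k
  obtain rfl | hk := eq_or_ne k i
  · rw [sumRep_apply, incl_apply_self, incl_apply_self]
  · rw [sumRep_apply, incl_apply_of_ne hk, incl_apply_of_ne hk, map_zero]

theorem blockProj_mem_centralizer (π : ∀ i, A →⋆ₐ[ℂ] (H i →L[ℂ] H i)) (i : ι) :
    blockProj H i ∈ Set.centralizer (Set.range (sumRep π)) := by
  rintro _ ⟨a, rfl⟩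
  exact ContinuousLinearMap.ext fun x => sumRep_incl π a i (x i)

theorem apply_incl_apply_eq_zero_of_disjointReps {S : HSum H →L[ℂ] HSum H}
    (hS : S ∈ Set.centralizer (Set.range (sumRep π))) {i k : ι}
    (hik : DisjointReps (π i) (π k)) (v : H i) : S (incl i v) k = 0 := by
  have intertwines : Intertwines (π i) (π k) (lp.evalCLM ℂ H 2 k ∘L S ∘L inclL H i) := by
    intro a x
    change S (incl i (π i a x)) k = π k a (S (incl i x) k)
    have hSa : sumRep π a (S (incl i x)) = S (sumRep π a (incl i x)) :=
      DFunLike.congr_fun (hS (sumRep π a) ⟨a, rfl⟩) (incl i x)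
    rw [← sumRep_incl, ← hSa, sumRep_apply]
  exact DFunLike.congr_fun (hik _ intertwines) v

theorem commute_of_mul_mul_eq_mul {R : Type*} [Semigroup R] [StarMul R] {p s : R}
    (hp : IsSelfAdjoint p) (hs : p * s * p = s * p) (hs' : p * star s * p = star s * p) :
    Commute s p :=
  calc s * p = p * s * p := hs.symm
    _ = star (p * star s * p) := by simp only [star_mul, star_star, hp.star_eq, mul_assoc]
    _ = p * s := by rw [hs', star_mul, star_star, hp.star_eq]

theorem blockProj_mem_doubleCommutant {i : ι} (hi : ∀ k ≠ i, DisjointReps (π i) (π k)) :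
    blockProj H i ∈ doubleCommutant π := by
  have block_invariant : ∀ S ∈ Set.centralizer (Set.range (sumRep π)),
      blockProj H i * S * blockProj H i = S * blockProj H i := by
    intro S hS
    ext x k
    change incl i (S (incl i (x i)) i) k = S (incl i (x i)) k
    obtain rfl | hk := eq_or_ne k i
    · rw [incl_apply_self]
    · rw [incl_apply_of_ne hk, apply_incl_apply_eq_zero_of_disjointReps hS (hi k hk)]
  intro S hS
  have star_mem : star S ∈ Set.centralizer (Set.range (sumRep π)) :=
    Set.star_mem_centralizer' (by rintro _ ⟨a, rfl⟩; exact ⟨star a, map_star _ a⟩) hS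
  exact commute_of_mul_mul_eq_mul (isStarProjection_blockProj i).isSelfAdjoint
    (block_invariant S hS) (block_invariant _ star_mem)

end Blocks

section Diagonal

variable {A : Type*} [CStarAlgebra A] {ι : Type*} {H : ι → Type*} [∀ i, NormedAddCommGroup (H i)]
  [∀ i, InnerProductSpace ℂ (H i)] [∀ i, CompleteSpace (H i)]
  {π : ∀ i, A →⋆ₐ[ℂ] (H i →L[ℂ] H i)}

theorem IsMinimalProj.mul_eq_zero_or_mul_eq_self {p e : HSum H →L[ℂ] HSum H}
    (hp : IsMinimalProj π p) (he : e ∈ doubleCommutant π) (he' : IsStarProjection e)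
    (hpe : Commute p e) : p * e = 0 ∨ p * e = p := by
  obtain ⟨hmem, hproj, -, hmin⟩ := hp
  have hpe' : IsStarProjection (p * e) := hproj.mul he' hpe
  refine hmin _ (Set.mul_mem_centralizer hmem he) hpe' ?_
  rw [hpe'.le_iff_mul_eq_right hproj, ← mul_assoc, hproj.isIdempotentElem.eq]

theorem IsMinimalProj.apply_incl_eq_zero_or {p : HSum H →L[ℂ] HSum H} (hp : IsMinimalProj π p)
    {i j : ι} (hi : ∀ k ≠ i, DisjointReps (π i) (π k)) (hij : i ≠ j) (v : H i) (w : H j) :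
    p (incl i v) = 0 ∨ p (incl j w) = 0 := by
  have hcomm : Commute p (blockProj H i) := (hp.1 _ (blockProj_mem_centralizer π i)).symm
  refine (hp.mul_eq_zero_or_mul_eq_self (blockProj_mem_doubleCommutant hi)
    (isStarProjection_blockProj i) hcomm).imp (fun h => ?_) (fun h => ?_)
  · rw [← blockProj_incl_self, ← mul_apply_eq_comp, h, zero_apply]
  · rw [← h, mul_apply_eq_comp, blockProj_incl_of_ne hij, map_zero]

theorem mem_diagSpace_orthogonal_iff {ξ : HTensor (HSum H) (HSum H)} :
    ξ ∈ (diagSpace π)ᗮ ↔ ∀ p, IsMinimalProj π p → (hmap p p : PairOp H) ξ = 0 := by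
  rw [diagSpace, Submodule.orthogonal_closure, ← Submodule.span_singleton_le_iff_mem,
    ← Submodule.isOrtho_iff_le]
  simp only [Submodule.isOrtho_iSup_right]
  refine forall₂_congr fun p hp => ?_
  have range_orthogonal : (hmap p p : PairOp H).rangeᗮ = (hmap p p : PairOp H).ker :=
    ContinuousLinearMap.IsStarNormal.orthogonal_range
      (isStarProjection_hmap hp.2.1).isSelfAdjoint.isStarNormal
  rw [Submodule.isOrtho_iff_le, Submodule.span_singleton_le_iff_mem, range_orthogonal]
  rfl

theorem htmul_incl_mem_diagSpace_orthogonal {i j : ι} (hi : ∀ k ≠ i, DisjointReps (π i) (π k))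
    (hij : i ≠ j) (v : H i) (w : H j) : htmul (incl i v) (incl j w) ∈ (diagSpace π)ᗮ := by
  refine mem_diagSpace_orthogonal_iff.2 fun p hp => ?_
  rw [hmap_htmul]
  rcases hp.apply_incl_eq_zero_or hi hij v w with h | h
  · rw [h, htmul_zero_left]
  · rw [h, htmul_zero_right]

end Diagonal

section Lipschitz

theorem enorm_apply_le_extOpNorm_mul {E F : Type*} [NormedAddCommGroup E] [NormedSpace ℂ E]
    [SeminormedAddCommGroup F] [NormedSpace ℂ F] (T : E →ₗ[ℂ] F) (x : E) :
    ‖T x‖ₑ ≤ extOpNorm T * ‖x‖ₑ := by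
  obtain rfl | hx := eq_or_ne x 0
  · rw [map_zero]
    simp [← ofReal_norm]
  have norm_x_ne_zero : (‖x‖ : ℂ) ≠ 0 := by simpa using hx
  set u : E := (‖x‖ : ℂ)⁻¹ • x with hu
  have norm_u : ‖u‖ ≤ 1 := by simp [hu, norm_smul, hx]
  calc ‖T x‖ₑ = ‖(‖x‖ : ℂ) • T u‖ₑ := by
        rw [← map_smul, hu, smul_inv_smul₀ norm_x_ne_zero]
    _ = ‖T u‖ₑ * ‖x‖ₑ := by simp [← ofReal_norm, norm_smul, ENNReal.ofReal_mul, mul_comm]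
    _ ≤ extOpNorm T * ‖x‖ₑ := by
        gcongr
        exact le_iSup₂ (f := fun (y : E) (_ : ‖y‖ ≤ 1) => ‖T y‖ₑ) u norm_u

variable {A : Type*} [CStarAlgebra A] {ι : Type*} {H : ι → Type*} [∀ i, NormedAddCommGroup (H i)]
  [∀ i, InnerProductSpace ℂ (H i)] [∀ i, CompleteSpace (H i)]
  {π : ∀ i, A →⋆ₐ[ℂ] (H i →L[ℂ] H i)}

theorem enorm_commOp_apply_le {ρ : PairOp H} (hρ : IsQuantumMetric π ρ) (a : A)
    {ξ : HTensor (HSum H) (HSum H)} (hξ : ξ ∈ (diagSpace π)ᗮ) :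
    ‖commOp π a ξ‖ₑ ≤ lipNorm hρ a * ‖ρ ξ‖ₑ := by
  have h := enorm_apply_le_extOpNorm_mul ((commOp π a).toLinearMap ∘ₗ rhoInv hρ)
    (LinearEquiv.ofInjective (offDiag π ρ) hρ.offDiag_injective ⟨ξ, hξ⟩)
  simp only [rhoInv, LinearMap.comp_apply, LinearEquiv.coe_coe, LinearEquiv.symm_apply_apply] at h
  exact h

theorem inner_commOp_htmul_incl (π : ∀ i, A →⋆ₐ[ℂ] (H i →L[ℂ] H i)) (a : A) {i j : ι}
    {v : H i} {w : H j} (hv : ‖v‖ = 1) (hw : ‖w‖ = 1) :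
    ⟪htmul (incl i v) (incl j w), commOp π a (htmul (incl i v) (incl j w))⟫_ℂ =
      (vectorState (π i) v hv).toLin a - (vectorState (π j) w hw).toLin a := by
  simp only [commOp, sub_apply, inner_sub_right, hmap_htmul, inner_htmul,
    sumRep_incl, inner_incl_left, incl_apply_self, ContinuousLinearMap.id_apply,
    inner_self_eq_norm_sq_to_K, norm_incl, hv, hw]
  simp [vectorState]

end Lipschitz

end QMetric

end

theorem mainTheorem7_general {A : Type*} [CStarAlgebra A] {ι : Type*} {H : ι → Type*}
    [∀ i, NormedAddCommGroup (H i)] [∀ i, InnerProductSpace ℂ (H i)] [∀ i, CompleteSpace (H i)]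
    (π : ∀ i, A →⋆ₐ[ℂ] (H i →L[ℂ] H i)) (ρ : QMetric.PairOp H) (hρ : QMetric.IsQuantumMetric π ρ)
    (i j : ι) (hi : ∀ k ≠ i, QMetric.DisjointReps (π i) (π k)) (hij : i ≠ j)
    (v : H i) (w : H j) (hv : ‖v‖ = 1) (hw : ‖w‖ = 1) :
    QMetric.mkDist hρ (QMetric.vectorState (π i) v hv) (QMetric.vectorState (π j) w hw) ≤
      ENNReal.ofReal ‖ρ (QMetric.htmul (QMetric.incl i v) (QMetric.incl j w))‖ := by
  set ξ := QMetric.htmul (QMetric.incl i v) (QMetric.incl j w) with hξ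
  have norm_ξ : ‖ξ‖ = 1 := by
    rw [hξ, QMetric.norm_htmul, QMetric.norm_incl, QMetric.norm_incl, hv, hw, one_mul]
  refine iSup_le fun a => iSup₂_le fun _ ha => ?_
  rw [← QMetric.inner_commOp_htmul_incl π a hv hw, ← hξ, ofReal_norm]
  calc ‖⟪ξ, QMetric.commOp π a ξ⟫_ℂ‖ₑ
      ≤ ‖QMetric.commOp π a ξ‖ₑ :=
        enorm_le_iff_norm_le.2 (by simpa [norm_ξ] using norm_inner_le_norm ξ (QMetric.commOp π a ξ))
    _ ≤ QMetric.lipNorm hρ a * ‖ρ ξ‖ₑ :=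
        QMetric.enorm_commOp_apply_le hρ a (QMetric.htmul_incl_mem_diagSpace_orthogonal hi hij v w)
    _ ≤ ‖ρ ξ‖ₑ := mul_le_of_le_one_left' ha

theorem mainTheorem7 {A : Type*} [CStarAlgebra A] {ι : Type*} {H : ι → Type*}
    [∀ i, NormedAddCommGroup (H i)] [∀ i, InnerProductSpace ℂ (H i)] [∀ i, CompleteSpace (H i)]
    (π : ∀ i, A →⋆ₐ[ℂ] (H i →L[ℂ] H i)) (hπ : QMetric.IsFaithfulAtomic π)
    (ρ : QMetric.PairOp H) (hρ : QMetric.IsQuantumMetric π ρ)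
    (i j : ι) (hij : i ≠ j) (v : H i) (w : H j) (hv : ‖v‖ = 1) (hw : ‖w‖ = 1) :
    QMetric.mkDist hρ (QMetric.vectorState (π i) v hv) (QMetric.vectorState (π j) w hw) ≤
      ENNReal.ofReal ‖ρ (QMetric.htmul (QMetric.incl i v) (QMetric.incl j w))‖ :=
  mainTheorem7_general π ρ hρ i j (fun _ hk => hπ.disjointReps hk.symm) hij v w hv hw
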